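/- Let $r, n \ge 0$ be integers, let $b_1,\dots,b_n \in \mathbb{Z}^r$, and let $R = \mathbb{Z}[x_1,\dots,x_r]$. For $b \in \mathbb{Z}^r$ write $b = b^+ - b^-$, where $b^+$ and $b^-$ are the entrywise positive and negative parts of $b$, and for $c \in \mathbb{N}^r$ write $x^c = \prod_{k=1}^r x_k^{c_k}$. Put $f_i^+ = x^{b_i^+}$, $f_i^- = x^{b_i^-}$, $f_i = f_i^+ - f_i^-$, let $\mathcal{I}_B = (f_1,\dots,f_n) \subseteq R$, and let $$\operatorname{Sat}_{x_1\cdots x_r}\mathcal{I}_B = \{a \in R : \text{there is an integer } m > 0 \text{ with } a\,(x_1\cdots x_r)^m \in \mathcal{I}_B\}$$ be its saturation with respect to $x_1\cdots x_r$. For $\varepsilon\colon \{1,\dots,n\}\to\{+,-\}$ and $t\colon\{1,\dots,n\}\to\mathbb{N}=\{0,1,2,\dots\}$ put $$S(\varepsilon,t) = \prod_{i=1}^n \bigl(f_i^{\varepsilon(i)}\bigr)^{t(i)} - \prod_{i=1}^n \bigl(f_i^{-\varepsilon(i)}\bigr)^{t(i)},$$ where $-\varepsilon(i)$ denotes the sign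 opposite to $\varepsilon(i)$. Then there exist a positive integer $M$, functions $\varepsilon_1,\dots,\varepsilon_M\colon\{1,\dots,n\}\to\{+,-\}$ and $t_1,\dots,t_M\colon\{1,\dots,n\}\to\mathbb{N}$, and monomials $m_1,\dots,m_M \in R$ (with coefficient $1$) such that 1. $m_j \mid S(\varepsilon_j,t_j)$ for all $1\le j\le M$; 2. $\displaystyle \operatorname{Sat}_{x_1\cdots x_r}\mathcal{I}_B = \left(\frac{S(\varepsilon_j,t_j)}{m_j} : 1\le j\le M\right).$ -/

import Mathlib

noncomputable section

namespace PureBinomial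

/-- The monomial `x^{b⁺}` of `ℤ[x_1, …, x_r]`, where `b⁺` is the entrywise positive part of `b`. -/
def monPos {r : ℕ} (b : Fin r → ℤ) : MvPolynomial (Fin r) ℤ :=
  ∏ k, MvPolynomial.X k ^ (b k).toNat

/-- The monomial `x^{b⁻}`, where `b⁻` is the entrywise negative part of `b`
(so that `b = b⁺ - b⁻` with both summands non-negative). -/
def monNeg {r : ℕ} (b : Fin r → ℤ) : MvPolynomial (Fin r) ℤ :=
  ∏ k, MvPolynomial.X k ^ (-(b k)).toNat

/-- The ideal `I_B = (x^{b⁺} - x^{b⁻} : b ∈ B)`. -/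
def idealOf {r : ℕ} (B : Set (Fin r → ℤ)) : Ideal (MvPolynomial (Fin r) ℤ) :=
  Ideal.span ((fun b => monPos b - monNeg b) '' B)

/-- The saturation of an ideal `I` with respect to an element `f`:
all `a` with `a * f ^ m ∈ I` for some `m > 0`. -/
def saturation {R : Type*} [CommRing R] (I : Ideal R) (f : R) : Ideal R where
  carrier := {a | ∃ m : ℕ, 0 < m ∧ a * f ^ m ∈ I}
  zero_mem' := ⟨1, one_pos, by simp⟩
  add_mem' := by
    rintro a b ⟨m, hm, ha⟩ ⟨k, hk, hb⟩
    refine ⟨m + k, by omega, ?_⟩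
    have h : (a + b) * f ^ (m + k) = f ^ k * (a * f ^ m) + f ^ m * (b * f ^ k) := by ring
    rw [h]
    exact I.add_mem (I.mul_mem_left _ ha) (I.mul_mem_left _ hb)
  smul_mem' := by
    rintro c a ⟨m, hm, ha⟩
    refine ⟨m, hm, ?_⟩
    rw [smul_eq_mul, mul_assoc]
    exact I.mul_mem_left _ ha

/-- For the binomial `f = f⁺ - f⁻ = x^{b⁺} - x^{b⁻}` and a sign `s = ±1`, the monomial `f^s`,
that is, `f⁺` if `s = 1` and `f⁻` if `s = -1`. -/
def signedMon {r : ℕ} (b : Fin r → ℤ) (s : ℤˣ) : MvPolynomial (Fin r) ℤ :=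
  if s = 1 then monPos b else monNeg b

/-- The iterated subtraction binomial
`S(ε, t) = ∏ i, (f_i^{ε i})^{t i} - ∏ i, (f_i^{-ε i})^{t i}` with `f_i = x^{b_i⁺} - x^{b_i⁻}`. -/
def iterSub {r n : ℕ} (b : Fin n → Fin r → ℤ) (ε : Fin n → ℤˣ) (t : Fin n → ℕ) :
    MvPolynomial (Fin r) ℤ :=
  ∏ i, signedMon (b i) (ε i) ^ t i - ∏ i, signedMon (b i) (-ε i) ^ t i

end PureBinomial

end

open MvPolynomial

namespace PureBinomial

variable {r n : ℕ}

/-! Let `L` be the lattice spanned by the `b i`. The saturation and the span of all quotients `S(ε,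
t) / m` both equal the kernel of the ring map from `ℤ[x]` to the group ring of `ℤ^r / L`. The map
kills each `f_i` and makes the variables invertible, so it kills the saturation. Conversely, two
monomials of the same class differ by a multiple of some quotient
(`monomial_sub_mem_span_quotients`), so the kernel lies in the span. The quotients lie in the
saturation because `S(ε, t) ∈ I_B` and `m` divides a power of `x_1 ⋯ x_r`. Noetherianity then leaves
finitely many generators. -/

/-- The exponent vector of the monomial `x^{b⁺}`. -/
noncomputable def posExp (b : Fin r → ℤ) : Fin r →₀ ℕ := Finsupp.equivFunOnFinite.symm fun k => (b k).toNat

/-- The exponent vector of `signedMon b s`. -/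
noncomputable def signedExp (b : Fin r → ℤ) (s : ℤˣ) : Fin r →₀ ℕ := if s = 1 then posExp b else posExp (-b)

/-- The image of an exponent vector in `ℤ^r`. -/
def intExp (r : ℕ) : (Fin r →₀ ℕ) →+ (Fin r → ℤ) where
  toFun u k := u k
  map_zero' := by ext; simp
  map_add' u v := by ext; simp

@[simp] lemma intExp_apply (u : Fin r →₀ ℕ) (k : Fin r) : intExp r u k = u k := rfl

lemma prod_X_pow (u : Fin r → ℕ) :
    ∏ k, (X k : MvPolynomial (Fin r) ℤ) ^ u k =
      monomial (Finsupp.equivFunOnFinite.symm u) 1 := by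
  rw [monomial_eq, Finsupp.prod_fintype _ _ fun _ => pow_zero _]
  simp

lemma monPos_eq_monomial (b : Fin r → ℤ) : monPos b = monomial (posExp b) 1 := prod_X_pow _

lemma monNeg_eq_monomial (b : Fin r → ℤ) : monNeg b = monomial (posExp (-b)) 1 := prod_X_pow _

lemma signedMon_eq_monomial (b : Fin r → ℤ) (s : ℤˣ) :
    signedMon b s = monomial (signedExp b s) 1 := by
  unfold signedMon signedExp
  split_ifs
  exacts [monPos_eq_monomial b, monNeg_eq_monomial b]

lemma intExp_posExp_sub (b : Fin r → ℤ) : intExp r (posExp b) - intExp r (posExp (-b)) = b := by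
  ext k
  simp [posExp]

lemma intExp_signedExp_sub (b : Fin r → ℤ) (s : ℤˣ) :
    intExp r (signedExp b s) - intExp r (signedExp b (-s)) = (s : ℤ) • b := by
  have h : (-1 : ℤˣ) ≠ 1 := by decide
  rcases Int.units_eq_one_or s with rfl | rfl
  · simpa [signedExp, h] using intExp_posExp_sub b
  · simpa [signedExp, h] using congrArg Neg.neg (intExp_posExp_sub b)

lemma prod_signedMon_pow (b : Fin n → Fin r → ℤ) (ε : Fin n → ℤˣ) (t : Fin n → ℕ) :
    ∏ i, signedMon (b i) (ε i) ^ t i = monomial (∑ i, t i • signedExp (b i) (ε i)) 1 := by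
  rw [monomial_sum_one]
  simp [signedMon_eq_monomial, monomial_pow]

lemma iterSub_eq (b : Fin n → Fin r → ℤ) (ε : Fin n → ℤˣ) (t : Fin n → ℕ) :
    iterSub b ε t = monomial (∑ i, t i • signedExp (b i) (ε i)) 1 -
      monomial (∑ i, t i • signedExp (b i) (-ε i)) 1 := by
  rw [iterSub, prod_signedMon_pow, prod_signedMon_pow b fun i => -ε i]

/-- The quotients of iterated subtraction binomials by monomials dividing them. -/
def quotients (b : Fin n → Fin r → ℤ) : Set (MvPolynomial (Fin r) ℤ) :=
  {g | ∃ (ε : Fin n → ℤˣ) (t : Fin n → ℕ) (m : Fin r →₀ ℕ),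
    monomial m (1 : ℤ) ∣ iterSub b ε t ∧ divMonomial (iterSub b ε t) m = g}

lemma zero_mem_quotients (b : Fin n → Fin r → ℤ) : 0 ∈ quotients b :=
  ⟨1, 0, 0, by simp [iterSub], by simp [iterSub]⟩

lemma signedMon_sub_mem (b : Fin n → Fin r → ℤ) (i : Fin n) (s : ℤˣ) :
    signedMon (b i) s - signedMon (b i) (-s) ∈ idealOf (Set.range b) := by
  have h : (-1 : ℤˣ) ≠ 1 := by decide
  have hi : monPos (b i) - monNeg (b i) ∈ idealOf (Set.range b) :=
    Ideal.subset_span ⟨b i, ⟨i, rfl⟩, rfl⟩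
  rcases Int.units_eq_one_or s with rfl | rfl
  · simpa [signedMon, h] using hi
  · simpa [signedMon, h] using neg_mem hi

/-- Modulo `I_B` each `f_i⁺` equals `f_i⁻`, so the two products agree. -/
lemma iterSub_mem_idealOf (b : Fin n → Fin r → ℤ) (ε : Fin n → ℤˣ) (t : Fin n → ℕ) :
    iterSub b ε t ∈ idealOf (Set.range b) := by
  rw [iterSub, ← Ideal.Quotient.eq, map_prod, map_prod]
  refine Finset.prod_congr rfl fun i _ => ?_
  rw [map_pow, map_pow, Ideal.Quotient.eq.2 (signedMon_sub_mem b i (ε i))]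

lemma monomial_dvd_prod_X_pow (m : Fin r →₀ ℕ) :
    -- The `+ 1` keeps the exponent positive, as `saturation` requires.
    (monomial m (1 : ℤ)) ∣ (∏ k, X k) ^ (∑ k, m k + 1) := by
  rw [monomial_eq, Finsupp.prod_fintype _ _ fun _ => pow_zero _, map_one, one_mul,
    ← Finset.prod_pow]
  exact Finset.prod_dvd_prod_of_dvd _ _ fun k hk => pow_dvd_pow _ <|
    (Finset.single_le_sum (fun i _ => Nat.zero_le (m i)) hk).trans (Nat.le_succ _)

lemma quotients_subset_saturation (b : Fin n → Fin r → ℤ) :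
    quotients b ⊆ saturation (idealOf (Set.range b)) (∏ k, X k) := by
  rintro _ ⟨ε, t, m, ⟨g, hg⟩, rfl⟩
  obtain ⟨d, hd⟩ := monomial_dvd_prod_X_pow m
  refine ⟨∑ k, m k + 1, Nat.succ_pos _, ?_⟩
  rw [hg, divMonomial_monomial_mul, hd,
    show g * (monomial m 1 * d) = d * (monomial m 1 * g) by ring, ← hg]
  exact Ideal.mul_mem_left _ _ (iterSub_mem_idealOf b ε t)

/-- The subgroup of `ℤ^r` generated by the exponent vectors `b i`. -/
def lattice (b : Fin n → Fin r → ℤ) : AddSubgroup (Fin r → ℤ) :=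
  (Submodule.span ℤ (Set.range b)).toAddSubgroup

lemma exists_signs_of_mem_lattice {b : Fin n → Fin r → ℤ} {a : Fin r → ℤ} (ha : a ∈ lattice b) :
    ∃ (ε : Fin n → ℤˣ) (t : Fin n → ℕ),
      intExp r (∑ i, t i • signedExp (b i) (ε i)) -
        intExp r (∑ i, t i • signedExp (b i) (-ε i)) = a := by
  obtain ⟨c, rfl⟩ := (Submodule.mem_span_range_iff_exists_fun ℤ).1 ha
  -- For `a = ∑ c i • b i`, take the signs and absolute values of the coefficients.
  refine ⟨fun i => if 0 ≤ c i then 1 else -1, fun i => (c i).natAbs, ?_⟩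
  simp only [map_sum, map_nsmul, ← Finset.sum_sub_distrib, ← smul_sub, intExp_signedExp_sub]
  refine Finset.sum_congr rfl fun i _ => ?_
  rw [← natCast_zsmul, smul_smul]
  congr 1
  split_ifs <;> simp only [Units.val_one, Units.val_neg] <;> omega

/-- A pure difference binomial divided by the gcd of its two terms depends only on the difference of
their exponents, and every vector of `L` is the exponent difference of some `S(ε, t)`. -/
lemma monomial_sub_mem_span_quotients {b : Fin n → Fin r → ℤ} {u v : Fin r →₀ ℕ}
    (h : intExp r u - intExp r v ∈ lattice b) :
    monomial u (1 : ℤ) - monomial v 1 ∈ Ideal.span (quotients b) := by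
  obtain ⟨ε, t, ht⟩ := exists_signs_of_mem_lattice h
  have hS := iterSub_eq b ε t
  generalize ∑ i, t i • signedExp (b i) (ε i) = p at hS ht
  generalize ∑ i, t i • signedExp (b i) (-ε i) = q at hS ht
  have hk (k) : (p k : ℤ) - q k = u k - v k := congrFun ht k
  have hp : p = p ⊓ q + (u - u ⊓ v) := by ext k; have := hk k; simp; omega
  have hq : q = p ⊓ q + (v - u ⊓ v) := by ext k; have := hk k; simp; omega
  have hu : u = u ⊓ v + (u - u ⊓ v) := by ext k; simp
  have hv : v = u ⊓ v + (v - u ⊓ v) := by ext k; simp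
  have hmul (w x y : Fin r →₀ ℕ) : (monomial (w + x) 1 - monomial (w + y) 1 :
      MvPolynomial (Fin r) ℤ) = monomial w 1 * (monomial x 1 - monomial y 1) := by
    simp [mul_sub, monomial_mul]
  have hS' : iterSub b ε t = monomial (p ⊓ q) 1 *
      (monomial (u - u ⊓ v) 1 - monomial (v - u ⊓ v) 1) := by
    rw [← hmul, ← hp, ← hq, hS]
  have huv : (monomial u 1 - monomial v 1 : MvPolynomial (Fin r) ℤ) = monomial (u ⊓ v) 1 *
      (monomial (u - u ⊓ v) 1 - monomial (v - u ⊓ v) 1) := by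
    rw [← hmul, ← hu, ← hv]
  rw [huv]
  refine Ideal.mul_mem_left _ _ (Ideal.subset_span ⟨ε, t, p ⊓ q, ⟨_, hS'⟩, ?_⟩)
  rw [hS', divMonomial_monomial_mul]

/-- The class of an exponent vector modulo the lattice. -/
noncomputable def expClass (b : Fin n → Fin r → ℤ) : (Fin r →₀ ℕ) →+ (Fin r → ℤ) ⧸ lattice b :=
  (QuotientAddGroup.mk' (lattice b)).comp (intExp r)

/-- The grading of polynomials by exponent classes, as a map to the group ring of `ℤ^r / L`. -/
noncomputable def toGroupRing (b : Fin n → Fin r → ℤ) :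
    MvPolynomial (Fin r) ℤ →+* AddMonoidAlgebra ℤ ((Fin r → ℤ) ⧸ lattice b) :=
  AddMonoidAlgebra.mapDomainRingHom ℤ (expClass b)

lemma toGroupRing_monomial (b : Fin n → Fin r → ℤ) (u : Fin r →₀ ℕ) (c : ℤ) :
    toGroupRing b (monomial u c) = AddMonoidAlgebra.single (expClass b u) c :=
  AddMonoidAlgebra.mapDomain_single

lemma expClass_eq_iff {b : Fin n → Fin r → ℤ} {u v : Fin r →₀ ℕ} :
    expClass b u = expClass b v ↔ intExp r u - intExp r v ∈ lattice b := by
  rw [← neg_mem_iff, neg_sub, ← neg_add_eq_sub]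
  exact QuotientAddGroup.eq

lemma toGroupRing_eq_zero_of_mem_idealOf {b : Fin n → Fin r → ℤ} {a : MvPolynomial (Fin r) ℤ}
    (ha : a ∈ idealOf (Set.range b)) : toGroupRing b a = 0 := by
  rw [← RingHom.mem_ker]
  refine Ideal.span_le.2 ?_ ha
  rintro _ ⟨_, ⟨i, rfl⟩, rfl⟩
  have h : expClass b (posExp (b i)) = expClass b (posExp (-b i)) := by
    rw [expClass_eq_iff, intExp_posExp_sub]
    exact Submodule.subset_span ⟨i, rfl⟩
  simp [RingHom.mem_ker, monPos_eq_monomial, monNeg_eq_monomial, toGroupRing_monomial, h]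

lemma isUnit_toGroupRing_prod_X (b : Fin n → Fin r → ℤ) :
    IsUnit (toGroupRing b (∏ k, X k)) := by
  have h : (∏ k, X k : MvPolynomial (Fin r) ℤ) =
      monomial (Finsupp.equivFunOnFinite.symm fun _ => 1) 1 := by
    simpa using prod_X_pow fun _ : Fin r => 1
  rw [h, toGroupRing_monomial]
  refine IsUnit.of_mul_eq_one (AddMonoidAlgebra.single
    (-expClass b (Finsupp.equivFunOnFinite.symm fun _ => 1)) 1) ?_
  rw [AddMonoidAlgebra.single_mul_single, add_neg_cancel, one_mul, AddMonoidAlgebra.one_def]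

/-- Modulo the quotients, each monomial may be replaced by a chosen representative of its class. The
resulting polynomial depends only on the image in the group ring, so it vanishes with that image. -/
lemma mem_span_quotients_of_toGroupRing_eq_zero {b : Fin n → Fin r → ℤ}
    {a : MvPolynomial (Fin r) ℤ} (ha : toGroupRing b a = 0) : a ∈ Ideal.span (quotients b) := by
  let s := Function.invFun (expClass b)
  let σ : AddMonoidAlgebra ℤ ((Fin r → ℤ) ⧸ lattice b) →+ MvPolynomial (Fin r) ℤ :=
    (Finsupp.liftAddHom fun x => (monomial (s x)).toAddMonoidHom).comp
      AddMonoidAlgebra.coeffAddEquiv.toAddMonoidHom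
  have key (p : MvPolynomial (Fin r) ℤ) :
      p - σ (toGroupRing b p) ∈ Ideal.span (quotients b) := by
    induction p using MvPolynomial.induction_on' with
    | monomial u c =>
      have hσ : σ (toGroupRing b (monomial u c)) = monomial (s (expClass b u)) c := by
        simp [σ, toGroupRing_monomial]
      have hs : expClass b u = expClass b (s (expClass b u)) :=
        (Function.invFun_eq ⟨u, rfl⟩).symm
      have h := Ideal.mul_mem_left _ (C c)
        (monomial_sub_mem_span_quotients (expClass_eq_iff.1 hs))
      rw [hσ]
      rwa [mul_sub, C_mul_monomial, C_mul_monomial, mul_one] at h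
    | add p q hp hq =>
      rw [map_add, map_add, add_sub_add_comm]
      exact add_mem hp hq
  simpa [ha] using key a

/-- The saturation of `I_B` is the lattice ideal, generated by all quotients of iterated
subtraction binomials by monomials. -/
theorem saturation_eq_span_quotients (b : Fin n → Fin r → ℤ) :
    saturation (idealOf (Set.range b)) (∏ k, X k) = Ideal.span (quotients b) := by
  refine le_antisymm ?_ (Ideal.span_le.2 (quotients_subset_saturation b))
  rintro a ⟨m, -, ha⟩
  refine mem_span_quotients_of_toGroupRing_eq_zero ?_
  have h := toGroupRing_eq_zero_of_mem_idealOf ha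
  rw [map_mul, map_pow] at h
  exact ((isUnit_toGroupRing_prod_X b).pow m).mul_left_eq_zero.1 h

end PureBinomial

theorem theorem3p4 (r n : ℕ) (b : Fin n → Fin r → ℤ) :
    ∃ (M : ℕ) (ε : Fin M → Fin n → ℤˣ) (t : Fin M → Fin n → ℕ) (m : Fin M → Fin r →₀ ℕ),
      0 < M ∧
      (∀ j, MvPolynomial.monomial (m j) (1 : ℤ) ∣ PureBinomial.iterSub b (ε j) (t j)) ∧
      PureBinomial.saturation (PureBinomial.idealOf (Set.range b)) (∏ k, MvPolynomial.X k) =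
        Ideal.span (Set.range fun j =>
          MvPolynomial.divMonomial (PureBinomial.iterSub b (ε j) (t j)) (m j)) := by
  classical
  obtain ⟨T, hTsub, hT⟩ := (Submodule.fg_span_iff_fg_span_finset_subset
    (PureBinomial.quotients b)).1 (IsNoetherian.noetherian (Ideal.span (PureBinomial.quotients b)))
  -- Adding the generator `0` ensures `0 < M` even if `T` is empty.
  let U := insert 0 T
  have hU (j : Fin U.card) : (U.equivFin.symm j : MvPolynomial (Fin r) ℤ) ∈
      PureBinomial.quotients b := by
    rcases Finset.mem_insert.1 (U.equivFin.symm j).2 with h | h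
    · rw [h]
      exact PureBinomial.zero_mem_quotients b
    · exact hTsub h
  choose ε t m hdvd hdiv using hU
  refine ⟨U.card, ε, t, m, Finset.card_pos.2 ⟨0, Finset.mem_insert_self _ _⟩, hdvd, ?_⟩
  have hrange : (Set.range fun j : Fin U.card => (U.equivFin.symm j : MvPolynomial (Fin r) ℤ)) =
      insert 0 (T : Set (MvPolynomial (Fin r) ℤ)) := by
    rw [← Finset.coe_insert]
    exact (U.equivFin.symm.surjective.range_comp Subtype.val).trans Subtype.range_coe
  simp only [hdiv]
  rw [PureBinomial.saturation_eq_span_quotients, hrange]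
  exact hT.trans Submodule.span_insert_zero.symm
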